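/- Let $n\ge 0$ be an integer and let $P$ be a prime ideal of the formal power series ring $\mathbb{C}[[z_1,\dots,z_n]]$ such that the quotient $\mathbb{C}[[z_1,\dots,z_n]]/P$ is infinite-dimensional as a complex vector space. Then there is a nonconstant formal curve $\zeta(t)=(\zeta_1(t),\dots,\zeta_n(t))$ through the origin, that is, a tuple of formal power series $\zeta_j\in\mathbb{C}[[t]]$ with $\zeta_j(0)=0$ for all $j$ and $\zeta_j\neq 0$ for some $j$, on which every element of $P$ vanishes to infinite order: for every $f\in P$, the formal power series $f(\zeta_1(t),\dots,\zeta_n(t))\in\mathbb{C}[[t]]$ is zero. -/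

import Mathlib

/-!
Write `R` for the ring of formal power series and `𝔪` for its maximal ideal. Since `R ⧸ 𝔪 = ℂ`, an
infinite-dimensional quotient forces `P ≠ 𝔪`. As `R` is Noetherian, `P` lies in a prime `Q` that is
maximal among the primes different from `𝔪`, and some variable `X j` is not in `Q`
(`IsLocalRing.exists_isPrime_maximal_ne`). The only prime containing `Q` and `X j` is `𝔪`, so
`R ⧸ (Q + (X j))` is finite-dimensional. Hence the domain `A = R ⧸ Q` is a finite extension of
`ℂ⟦t⟧` through `t ↦ X j`, because `ℂ⟦t⟧` is complete
(`PowerSeries.finite_of_finite_quotient_span_X`).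

The integral closure of `ℂ⟦t⟧` in the fraction field of `A` is a Dedekind domain whose residue
fields are all `ℂ`. Localizing at a maximal ideal gives a discrete valuation ring containing `A`,
with residue field `ℂ`, and expanding its elements in powers of a uniformizer embeds it in `ℂ⟦s⟧`
(`PowerSeries.exists_injective_algHom_of_uniformizer`). No completion is needed for this.

The composite `R → A → ℂ⟦s⟧` kills `P` and not `X j`. Finally, every algebra map `R → ℂ⟦s⟧` is the
substitution of the images of the variables, and these images have no constant term
(`MvPowerSeries.algHom_eq_subst`, `MvPowerSeries.algHom_constantCoeff_X_eq_zero`).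
-/

/-! ### The maximal ideal and algebra maps to one-variable power series -/

theorem PowerSeries.eq_zero_of_forall_X_pow_dvd {k : Type*} [CommRing k] {f : PowerSeries k}
    (h : ∀ n, (X : PowerSeries k) ^ n ∣ f) : f = 0 := by
  ext n
  exact X_pow_dvd_iff.mp (h (n + 1)) n n.lt_succ_self

theorem MvPowerSeries.mem_span_range_X_of_constantCoeff_eq_zero {σ k : Type*} [Finite σ]
    [CommRing k] {f : MvPowerSeries σ k} (hf : constantCoeff f = 0) :
    f ∈ Ideal.span (Set.range (X : σ → MvPowerSeries σ k)) := by
  classical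
  cases nonempty_fintype σ
  -- Each nonzero exponent `e` is charged to one variable `i` occurring in it.
  have hex : ∀ e : {e : σ →₀ ℕ // e ≠ 0}, ∃ i, e.1 i ≠ 0 := fun e => Finsupp.ne_iff.mp e.2
  choose ι hι using hex
  let g : σ → MvPowerSeries σ k := fun i e =>
    if h : e ≠ 0 then if ι ⟨e, h⟩ = i then coeff e f else 0 else 0
  have hg : ∀ i e, coeff e (g i) =
      if h : e ≠ 0 then if ι ⟨e, h⟩ = i then coeff e f else 0 else 0 := fun _ _ => rfl
  have hfg : f = ∑ i, g i := by
    ext e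
    rw [map_sum]
    simp only [hg]
    by_cases he : e = 0
    · subst he
      simpa using hf
    · simp [he]
  rw [hfg]
  refine Ideal.sum_mem _ fun i _ => ?_
  have hdvd : (X i : MvPowerSeries σ k) ∣ g i := by
    refine X_dvd_iff.mpr fun e he => ?_
    rw [hg]
    split_ifs with h h'
    · subst h'
      exact (hι ⟨e, h⟩ he).elim
    · rfl
    · rfl
  exact Ideal.mem_of_dvd _ hdvd (Ideal.subset_span ⟨i, rfl⟩)

theorem MvPowerSeries.maximalIdeal_eq_span_range_X (σ k : Type*) [Finite σ] [Field k] :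
    IsLocalRing.maximalIdeal (MvPowerSeries σ k) =
      Ideal.span (Set.range (X : σ → MvPowerSeries σ k)) := by
  apply le_antisymm
  · intro f hf
    apply mem_span_range_X_of_constantCoeff_eq_zero
    rw [IsLocalRing.mem_maximalIdeal, mem_nonunits_iff, isUnit_iff_constantCoeff,
      isUnit_iff_ne_zero, not_not] at hf
    exact hf
  · rw [Ideal.span_le]
    rintro _ ⟨i, rfl⟩
    simp [isUnit_iff_constantCoeff]

/-- The constant coefficient of `Φ` is a map onto the field `k`, so its kernel is the maximal ideal,
which contains the variables. -/
theorem MvPowerSeries.algHom_constantCoeff_X_eq_zero {σ k : Type*} [Finite σ] [Field k]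
    (Φ : MvPowerSeries σ k →ₐ[k] PowerSeries k) (i : σ) :
    PowerSeries.constantCoeff (Φ (X i)) = 0 := by
  set χ : MvPowerSeries σ k →+* k := (PowerSeries.constantCoeff (R := k)).comp Φ.toRingHom
  have hχ : Function.Surjective χ := fun c =>
    ⟨algebraMap k _ c, by simp [χ]⟩
  have hmax := IsLocalRing.eq_maximalIdeal (RingHom.ker_isMaximal_of_surjective χ hχ)
  have : (X i : MvPowerSeries σ k) ∈ RingHom.ker χ := by
    rw [hmax, maximalIdeal_eq_span_range_X]
    exact Ideal.subset_span ⟨i, rfl⟩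
  exact this

/-- An algebra map to `k⟦X⟧` is automatically continuous: the error of the substitution formula
gains a factor `X` each time a series without constant term is expanded in the variables. -/
theorem MvPowerSeries.algHom_eq_subst {σ k : Type*} [Finite σ] [Field k]
    (Φ : MvPowerSeries σ k →ₐ[k] PowerSeries k) (f : MvPowerSeries σ k) :
    Φ f = subst (fun i => Φ (X i)) f := by
  have h0 := algHom_constantCoeff_X_eq_zero Φ
  have ha : HasSubst (fun i => Φ (X i)) := hasSubst_of_constantCoeff_zero h0
  rw [← substAlgHom_apply ha, ← sub_eq_zero]
  set Ψ : MvPowerSeries σ k →ₐ[k] PowerSeries k := substAlgHom ha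
  have hX : ∀ i, Φ (X i) = Ψ (X i) := fun i => (substAlgHom_X ha i).symm
  apply PowerSeries.eq_zero_of_forall_X_pow_dvd
  intro n
  induction n generalizing f with
  | zero => simp
  | succ n ih =>
    suffices h : ∀ g ∈ Ideal.span (Set.range (X : σ → MvPowerSeries σ k)),
        (PowerSeries.X : PowerSeries k) ^ (n + 1) ∣ Φ g - Ψ g by
      have := h (f - algebraMap k _ (constantCoeff f))
        (mem_span_range_X_of_constantCoeff_eq_zero (by simp [algebraMap_apply]))
      simpa using this
    intro g hg
    induction hg using Submodule.span_induction with
    | mem g hg =>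
      obtain ⟨i, rfl⟩ := hg
      simp [hX]
    | zero => simp
    | add g₁ g₂ _ _ h₁ h₂ =>
      rw [map_add, map_add, add_sub_add_comm]
      exact dvd_add h₁ h₂
    | smul r g hg h =>
      have hdvd : (PowerSeries.X : PowerSeries k) ∣ Φ g := by
        have hle : Ideal.span (Set.range (X : σ → MvPowerSeries σ k)) ≤
            (Ideal.span {(PowerSeries.X : PowerSeries k)}).comap Φ := by
          rw [Ideal.span_le]
          rintro _ ⟨i, rfl⟩
          exact Ideal.mem_span_singleton.mpr (PowerSeries.X_dvd_iff.mpr (h0 i))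
        exact Ideal.mem_span_singleton.mp (hle hg)
      have : Φ (r • g) - Ψ (r • g) = Φ g * (Φ r - Ψ r) + Ψ r * (Φ g - Ψ g) := by
        simp only [smul_eq_mul, map_mul]
        ring
      rw [this, pow_succ']
      rw [pow_succ'] at h
      exact dvd_add (mul_dvd_mul hdvd (ih r)) (h.mul_left _)

/-! ### Expansions in powers of one element -/

theorem PowerSeries.mk_eq_C_add_X_mul {k : Type*} [CommRing k] (u : ℕ → k) :
    PowerSeries.mk u = C (u 0) + X * PowerSeries.mk fun n => u (n + 1) := by
  ext n
  cases n <;> simp [coeff_succ_X_mul]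

theorem PowerSeries.injective_algHom_of_map_X_ne_zero {k A : Type*} [Field k] [CommRing A]
    [IsDomain A] [Algebra k A] (φ : PowerSeries k →ₐ[k] A) (hx0 : φ X ≠ 0) :
    Function.Injective φ := by
  refine (injective_iff_map_eq_zero φ).mpr fun f hf => ?_
  apply eq_zero_of_forall_X_pow_dvd
  intro n
  induction n with
  | zero => simp
  | succ n ih =>
    obtain ⟨g, rfl⟩ := ih
    rw [map_mul, map_pow] at hf
    have hg := (mul_eq_zero.mp hf).resolve_left (pow_ne_zero n hx0)
    rw [pow_succ]
    refine mul_dvd_mul_left _ (X_dvd_iff.mpr ?_)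
    by_contra hc
    exact not_isUnit_zero (hg ▸ (isUnit_iff_constantCoeff.mpr
      (isUnit_iff_ne_zero.mpr hc)).map φ)

/-- Completeness of `k⟦X⟧` lifts finiteness modulo `φ X`: dividing repeatedly by `φ X` produces the
coefficients of the power series expressing a given element in terms of fixed generators. -/
theorem PowerSeries.finite_of_finite_quotient_span_X {k A : Type*} [CommRing k] [CommRing A]
    [Algebra k A] (φ : PowerSeries k →ₐ[k] A)
    [Module.Finite k (A ⧸ Ideal.span {φ X})]
    (hsep : ∀ a : A, (∀ n, φ X ^ n ∣ a) → a = 0) : φ.toRingHom.Finite := by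
  obtain ⟨r, e, he⟩ := Module.Finite.exists_fin (R := k) (M := A ⧸ Ideal.span {φ X})
  choose b hb using fun i => Ideal.Quotient.mk_surjective (e i)
  -- Modulo `φ X` every element is a `k`-combination of the `b i`.
  have hstep : ∀ a : A, ∃ (c : Fin r → k) (a' : A),
      a = ∑ i, algebraMap k A (c i) * b i + φ X * a' := by
    intro a
    have ha : Ideal.Quotient.mk (Ideal.span {φ X}) a ∈ Submodule.span k (Set.range e) :=
      he ▸ Submodule.mem_top
    obtain ⟨c, hc⟩ := (Submodule.mem_span_range_iff_exists_fun k).mp ha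
    have hmem : a - ∑ i, algebraMap k A (c i) * b i ∈ Ideal.span {φ X} := by
      rw [← Ideal.Quotient.eq_zero_iff_mem, map_sub, ← hc, map_sum, sub_eq_zero]
      refine Finset.sum_congr rfl fun i _ => ?_
      rw [← hb, map_mul, Algebra.smul_def]
      rfl
    obtain ⟨a', ha'⟩ := Ideal.mem_span_singleton.mp hmem
    exact ⟨c, a', by rw [← ha']; ring⟩
  choose c s hcs using hstep
  -- Iterating the division gives, for each generator `b i`, a power series of coefficients.
  let F : A → Fin r → PowerSeries k := fun a i => PowerSeries.mk fun n => c (s^[n] a) i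
  have hF : ∀ a i, F a i = C (c a i) + X * F (s a) i := fun a i =>
    mk_eq_C_add_X_mul fun n => c (s^[n] a) i
  have hrec : ∀ a, a - ∑ i, φ (F a i) * b i = φ X * (s a - ∑ i, φ (F (s a) i) * b i) := by
    intro a
    have hC : ∀ y : k, φ (C y) = algebraMap k A y := fun y => φ.commutes y
    simp only [hF a, map_add, map_mul, hC, add_mul, Finset.sum_add_distrib, mul_sub,
      Finset.mul_sum, mul_assoc]
    linear_combination hcs a
  have hall : ∀ n a, φ X ^ n ∣ a - ∑ i, φ (F a i) * b i := by
    intro n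
    induction n with
    | zero => simp
    | succ n ih =>
      intro a
      rw [hrec, pow_succ']
      exact mul_dvd_mul_left _ (ih _)
  let _ : Algebra (PowerSeries k) A := φ.toRingHom.toAlgebra
  refine (Module.finite_def (R := PowerSeries k) (M := A)).mpr ?_
  refine Submodule.fg_def.mpr ⟨Set.range b, Set.finite_range b, ?_⟩
  rw [eq_top_iff]
  intro a _
  exact (Submodule.mem_span_range_iff_exists_fun _).mpr
    ⟨F a, (sub_eq_zero.mp (hsep _ fun n => hall n a)).symm⟩

/-- If `k` maps onto the residue ring of `V` at `π`, then sending an element to the sequence of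
digits of its `π`-adic expansion is an algebra map to `k⟦X⟧`: all identities hold modulo every power of `X`
by induction on the number of digits. Injectivity is the separatedness hypothesis `hsep`. -/
theorem PowerSeries.exists_injective_algHom_of_uniformizer {k V : Type*} [Field k] [CommRing V]
    [IsDomain V] [Algebra k V] (π : V) (hπ0 : π ≠ 0) (hπ : ¬ IsUnit π)
    (hres : ∀ a : V, ∃ c : k, π ∣ a - algebraMap k V c)
    (hsep : ∀ a : V, (∀ n, π ^ n ∣ a) → a = 0) :
    ∃ ψ : V →ₐ[k] PowerSeries k, Function.Injective ψ := by
  have hstep : ∀ a : V, ∃ (c : k) (a' : V), a = algebraMap k V c + π * a' := by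
    intro a
    obtain ⟨c, a', h⟩ := hres a
    exact ⟨c, a', by rw [← h]; ring⟩
  -- The leading digit is unique because a nonzero constant is a unit and `π` is not.
  have huniq : ∀ (c d : k) (a b : V), algebraMap k V c + π * a = algebraMap k V d + π * b →
      c = d ∧ a = b := by
    intro c d a b h
    have hcd : c = d := by
      by_contra hne
      refine hπ (isUnit_of_dvd_unit ⟨b - a, ?_⟩
        ((isUnit_iff_ne_zero.mpr (sub_ne_zero.mpr hne)).map (algebraMap k V)))
      rw [map_sub]
      linear_combination h
    subst hcd
    exact ⟨rfl, mul_left_cancel₀ hπ0 (add_left_cancel h)⟩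
  choose c s hcs using hstep
  have hcs' : ∀ (a : V) (d : k) (a' : V), a = algebraMap k V d + π * a' → c a = d ∧ s a = a' :=
    fun a d a' h => huniq _ _ _ _ ((hcs a).symm.trans h)
  let ψ : V → PowerSeries k := fun a => PowerSeries.mk fun n => c (s^[n] a)
  have hψ : ∀ a, ψ a = C (c a) + X * ψ (s a) := fun a => mk_eq_C_add_X_mul fun n => c (s^[n] a)
  have hψ' : ∀ (d : k) (a' : V), ψ (algebraMap k V d + π * a') = C d + X * ψ a' := by
    intro d a'
    obtain ⟨h1, h2⟩ := hcs' _ d a' rfl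
    rw [hψ, h1, h2]
  have hadd : ∀ a b, ψ (a + b) = ψ a + ψ b := by
    intro a b
    rw [← sub_eq_zero]
    apply eq_zero_of_forall_X_pow_dvd
    intro n
    induction n generalizing a b with
    | zero => simp
    | succ n ih =>
      have : ψ (a + b) - (ψ a + ψ b) = X * (ψ (s a + s b) - (ψ (s a) + ψ (s b))) := by
        have hab : a + b = algebraMap k V (c a + c b) + π * (s a + s b) := by
          rw [map_add]
          linear_combination hcs a + hcs b
        rw [hab, hψ', hψ a, hψ b, map_add]
        ring
      rw [this, pow_succ']
      exact mul_dvd_mul_left _ (ih _ _)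
  have h00 : ψ 0 = 0 := by simpa using hadd 0 0
  have hC : ∀ d : k, ψ (algebraMap k V d) = C d := by
    intro d
    simpa [h00] using hψ' d 0
  have hX : ∀ a, ψ (π * a) = X * ψ a := by
    intro a
    simpa using hψ' 0 a
  have hCmul : ∀ (d : k) (b : V), ψ (algebraMap k V d * b) = C d * ψ b := by
    intro d b
    rw [← sub_eq_zero]
    apply eq_zero_of_forall_X_pow_dvd
    intro n
    induction n generalizing b with
    | zero => simp
    | succ n ih =>
      have : ψ (algebraMap k V d * b) - C d * ψ b
          = X * (ψ (algebraMap k V d * s b) - C d * ψ (s b)) := by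
        have hb : algebraMap k V d * b
            = algebraMap k V (d * c b) + π * (algebraMap k V d * s b) := by
          rw [map_mul]
          linear_combination algebraMap k V d * hcs b
        rw [hb, hψ', hψ b, map_mul]
        ring
      rw [this, pow_succ']
      exact mul_dvd_mul_left _ (ih _)
  have hmul : ∀ a b, ψ (a * b) = ψ a * ψ b := by
    intro a b
    rw [← sub_eq_zero]
    apply eq_zero_of_forall_X_pow_dvd
    intro n
    induction n generalizing a with
    | zero => simp
    | succ n ih =>
      have : ψ (a * b) - ψ a * ψ b = X * (ψ (s a * b) - ψ (s a) * ψ b) := by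
        have hab : a * b = algebraMap k V (c a) * b + π * (s a * b) := by
          linear_combination b * hcs a
        rw [hab, hadd, hCmul, hX, hψ a]
        ring
      rw [this, pow_succ']
      exact mul_dvd_mul_left _ (ih _)
  let Ψ : V →ₐ[k] PowerSeries k :=
    { toFun := ψ
      map_one' := by simpa using hC 1
      map_mul' := hmul
      map_zero' := h00
      map_add' := hadd
      commutes' := hC }
  refine ⟨Ψ, (injective_iff_map_eq_zero Ψ).mpr fun a ha => hsep a fun n => ?_⟩
  change ψ a = 0 at ha
  induction n generalizing a with
  | zero => simp
  | succ n ih =>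
    have hca : c a = 0 := by simpa [ψ] using congrArg (coeff 0) ha
    have hsa : ψ (s a) = 0 := by
      have := hψ a
      rw [ha, hca, map_zero, zero_add] at this
      exact (mul_eq_zero.mp this.symm).resolve_left X_ne_zero
    rw [hcs a, hca, map_zero, zero_add, pow_succ']
    exact mul_dvd_mul_left _ (ih _ hsa)

/-! ### Normalization of a finite extension of `k⟦X⟧` -/

/-- Characteristic zero enters here: it makes the extension of fraction fields separable. -/
theorem IsDedekindDomain.integralClosure_fractionRing_of_finite (O A : Type*) [CommRing O]
    [IsDedekindDomain O] [CharZero O] [CommRing A] [IsDomain A] [Algebra O A] [Module.Finite O A]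
    [FaithfulSMul O A] : IsDedekindDomain (integralClosure O (FractionRing A)) := by
  let _ : Algebra (FractionRing O) (FractionRing A) := FractionRing.liftAlgebra O (FractionRing A)
  have : IsScalarTower O (FractionRing O) (FractionRing A) := inferInstance
  have : FiniteDimensional (FractionRing O) (FractionRing A) :=
    .of_isLocalization O A (nonZeroDivisors O)
  have : CharZero (FractionRing O) := inferInstance
  have : Algebra.IsSeparable (FractionRing O) (FractionRing A) := inferInstance
  exact integralClosure.isDedekindDomain O (FractionRing O) (FractionRing A)

/-- The maximal ideal `M` lies over that of `k⟦X⟧`, so its residue field is algebraic over `k`,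
hence equal to `k`. -/
theorem PowerSeries.X_mem_and_exists_sub_mem_of_isIntegral {k B : Type*} [Field k] [IsAlgClosed k]
    [CommRing B] [Algebra k B] [Algebra (PowerSeries k) B] [IsScalarTower k (PowerSeries k) B]
    [Algebra.IsIntegral (PowerSeries k) B] (M : Ideal B) [hM : M.IsMaximal] :
    algebraMap (PowerSeries k) B X ∈ M ∧ ∀ y : B, ∃ c : k, y - algebraMap k B c ∈ M := by
  have hXM : algebraMap (PowerSeries k) B X ∈ M := by
    have := IsLocalRing.eq_maximalIdeal
      (Ideal.isMaximal_comap_of_isIntegral_of_isMaximal (R := PowerSeries k) M)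
    rw [← Ideal.mem_comap, this, maximalIdeal_eq_span_X]
    exact Ideal.mem_span_singleton_self X
  refine ⟨hXM, fun y => ?_⟩
  let q : PowerSeries k →+* B ⧸ M := (Ideal.Quotient.mk M).comp (algebraMap (PowerSeries k) B)
  let g : k →+* B ⧸ M := (Ideal.Quotient.mk M).comp (algebraMap k B)
  have hq : q = g.comp (constantCoeff (R := k)) := by
    refine RingHom.ext fun f => ?_
    obtain ⟨h, hh⟩ : X ∣ f - C (constantCoeff f) := X_dvd_iff.mpr (by simp)
    refine Ideal.Quotient.eq.mpr ?_
    rw [IsScalarTower.algebraMap_apply k (PowerSeries k) B, ← map_sub]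
    change algebraMap (PowerSeries k) B (f - C (constantCoeff f)) ∈ M
    rw [hh, map_mul]
    exact M.mul_mem_right _ hXM
  have hqint : q.IsIntegral := RingHom.IsIntegral.trans _ _
    (algebraMap_isIntegral_iff.mpr inferInstance)
    (RingHom.isIntegral_of_surjective _ Ideal.Quotient.mk_surjective)
  have hg : g.IsIntegral := by
    rw [hq] at hqint
    exact RingHom.IsIntegral.tower_top _ g hqint
  obtain ⟨c, hc⟩ := (IsAlgClosed.ringHom_bijective_of_isIntegral g hg).2 (Ideal.Quotient.mk M y)
  exact ⟨c, Ideal.Quotient.eq.mp hc.symm⟩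

theorem PowerSeries.exists_injective_algHom_of_isDedekindDomain {k B : Type*} [Field k]
    [CommRing B] [IsDedekindDomain B] [Algebra k B] (M : Ideal B) [M.IsMaximal] (hM0 : M ≠ ⊥)
    (hres : ∀ y : B, ∃ c : k, y - algebraMap k B c ∈ M) :
    ∃ ψ : B →ₐ[k] PowerSeries k, Function.Injective ψ := by
  let V := Localization.AtPrime M
  have : IsDiscreteValuationRing V :=
    IsLocalization.AtPrime.isDiscreteValuationRing_of_dedekind_domain B hM0 V
  obtain ⟨π, hπ⟩ := IsDiscreteValuationRing.exists_irreducible V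
  have hmax : IsLocalRing.maximalIdeal V = Ideal.span {π} := hπ.maximalIdeal_eq
  have hresV : ∀ a : V, ∃ c : k, π ∣ a - algebraMap k V c := by
    intro a
    obtain ⟨y, hy⟩ := (IsLocalization.AtPrime.equivQuotMaximalIdeal M V).surjective
      (Ideal.Quotient.mk _ a)
    obtain ⟨y, rfl⟩ := Ideal.Quotient.mk_surjective y
    rw [IsLocalization.AtPrime.equivQuotMaximalIdeal_apply_mk] at hy
    obtain ⟨c, hc⟩ := hres y
    refine ⟨c, ?_⟩
    rw [← Ideal.mem_span_singleton, ← hmax]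
    have h1 := Ideal.Quotient.eq.mp hy.symm
    have h2 : algebraMap B V (y - algebraMap k B c) ∈ IsLocalRing.maximalIdeal V :=
      (IsLocalization.AtPrime.to_map_mem_maximal_iff V M _).mpr hc
    rw [map_sub, ← IsScalarTower.algebraMap_apply] at h2
    simpa using add_mem h1 h2
  have hsep : ∀ a : V, (∀ n, π ^ n ∣ a) → a = 0 := by
    intro a ha
    have h := Ideal.iInf_pow_eq_bot_of_isLocalRing (IsLocalRing.maximalIdeal V)
      (IsLocalRing.maximalIdeal.isMaximal V).ne_top
    rw [← Ideal.mem_bot, ← h, Ideal.mem_iInf]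
    intro n
    rw [hmax, Ideal.span_singleton_pow, Ideal.mem_span_singleton]
    exact ha n
  obtain ⟨ψ, hψ⟩ := exists_injective_algHom_of_uniformizer π hπ.ne_zero hπ.not_isUnit hresV hsep
  have hBV : Function.Injective (IsScalarTower.toAlgHom k B V) :=
    IsLocalization.injective V M.primeCompl_le_nonZeroDivisors
  exact ⟨ψ.comp (IsScalarTower.toAlgHom k B V), hψ.comp hBV⟩

/-- A one-dimensional analytic domain is parametrized by one branch of its normalization. -/
theorem PowerSeries.exists_injective_algHom_of_finite {k A : Type*} [Field k] [IsAlgClosed k]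
    [CharZero k] [CommRing A] [IsDomain A] [Algebra k A] [Algebra (PowerSeries k) A]
    [IsScalarTower k (PowerSeries k) A] [Module.Finite (PowerSeries k) A]
    [FaithfulSMul (PowerSeries k) A] :
    ∃ ψ : A →ₐ[k] PowerSeries k, Function.Injective ψ := by
  have : CharZero (PowerSeries k) := charZero_of_injective_algebraMap (C_injective (R := k))
  have := IsDedekindDomain.integralClosure_fractionRing_of_finite (PowerSeries k) A
  let B := integralClosure (PowerSeries k) (FractionRing A)
  obtain ⟨M, hM⟩ := Ideal.exists_maximal B
  obtain ⟨hXM, hres⟩ := X_mem_and_exists_sub_mem_of_isIntegral (k := k) M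
  have hOB : Function.Injective (algebraMap (PowerSeries k) B) :=
    Function.Injective.of_comp (f := Subtype.val)
      (FaithfulSMul.algebraMap_injective (PowerSeries k) (FractionRing A))
  have hM0 : M ≠ ⊥ := by
    rintro rfl
    exact X_ne_zero ((map_eq_zero_iff _ hOB).mp (Ideal.mem_bot.mp hXM))
  obtain ⟨ψ, hψ⟩ := exists_injective_algHom_of_isDedekindDomain M hM0 hres
  have hAB : ∀ a : A, algebraMap A (FractionRing A) a ∈ B := fun a =>
    (Algebra.IsIntegral.isIntegral (R := PowerSeries k) a).map
      (IsScalarTower.toAlgHom (PowerSeries k) A (FractionRing A))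
  let ι : A →ₐ[k] B :=
    { (algebraMap A (FractionRing A)).codRestrict B hAB with
      commutes' := fun c =>
        Subtype.ext (IsScalarTower.algebraMap_apply k A (FractionRing A) c).symm }
  have hι : Function.Injective ι := fun a b hab =>
    IsFractionRing.injective A (FractionRing A) (congrArg Subtype.val hab)
  exact ⟨ψ.comp ι, hψ.comp hι⟩

/-! ### Reduction to dimension one -/

/-- In geometric terms: every irreducible germ of positive dimension contains an irreducible germ of
dimension one. -/
theorem IsLocalRing.exists_isPrime_maximal_ne {R : Type*} [CommRing R] [IsNoetherianRing R]
    [IsLocalRing R] (P : Ideal R) [hP : P.IsPrime] (hne : P ≠ IsLocalRing.maximalIdeal R) :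
    ∃ Q : Ideal R, P ≤ Q ∧ Q.IsPrime ∧ Q ≠ IsLocalRing.maximalIdeal R ∧
      ∀ q : Ideal R, q.IsPrime → Q < q → q = IsLocalRing.maximalIdeal R := by
  obtain ⟨Q, ⟨hPQ, hQ, hQm⟩, hmax⟩ := set_has_maximal_iff_noetherian.mpr ‹IsNoetherianRing R›
    {Q : Ideal R | P ≤ Q ∧ Q.IsPrime ∧ Q ≠ IsLocalRing.maximalIdeal R} ⟨P, le_rfl, hP, hne⟩
  refine ⟨Q, hPQ, hQ, hQm, fun q hq hlt => ?_⟩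
  by_contra hqm
  exact hmax q ⟨hPQ.trans hlt.le, hq, hqm⟩ hlt

theorem IsLocalRing.finite_quotient_of_pow_maximalIdeal_le {k R : Type*} [CommRing k] [CommRing R]
    [IsNoetherianRing R] [IsLocalRing R] [Algebra k R]
    [Module.Finite k (R ⧸ IsLocalRing.maximalIdeal R)] {I : Ideal R} {N : ℕ}
    (hI : IsLocalRing.maximalIdeal R ^ N ≤ I) : Module.Finite k (R ⧸ I) := by
  by_cases hIm : I = ⊤
  · subst hIm
    infer_instance
  have hI' : I ≤ IsLocalRing.maximalIdeal R := IsLocalRing.le_maximalIdeal hIm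
  refine Module.finite_of_surjective_of_ker_le_nilradical
    (T := R ⧸ IsLocalRing.maximalIdeal R) (Ideal.Quotient.factorₐ k hI')
    (Ideal.Quotient.factor_surjective hI') ?_ (IsNoetherian.noetherian _)
  intro a ha
  obtain ⟨a, rfl⟩ := Ideal.Quotient.mk_surjective a
  have : a ∈ IsLocalRing.maximalIdeal R := Ideal.Quotient.eq_zero_iff_mem.mp ha
  refine ⟨N, ?_⟩
  rw [← map_pow]
  exact Ideal.Quotient.eq_zero_iff_mem.mpr (hI (Ideal.pow_mem_pow this N))

/-! ### Curves through the origin -/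

theorem MvPowerSeries.finite_quotient_maximalIdeal (σ k : Type*) [Finite σ] [Field k] :
    Module.Finite k (MvPowerSeries σ k ⧸ IsLocalRing.maximalIdeal (MvPowerSeries σ k)) := by
  refine Module.Finite.of_surjective (Algebra.linearMap k _) fun a => ?_
  obtain ⟨f, rfl⟩ := Ideal.Quotient.mk_surjective a
  refine ⟨constantCoeff f, ?_⟩
  rw [Algebra.linearMap_apply, ← sub_eq_zero, IsScalarTower.algebraMap_apply k (MvPowerSeries σ k),
    Ideal.Quotient.algebraMap_eq, ← map_sub, Ideal.Quotient.eq_zero_iff_mem,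
    maximalIdeal_eq_span_range_X]
  exact mem_span_range_X_of_constantCoeff_eq_zero (by simp [algebraMap_apply])

/-- Curve selection in parametrized form: a prime ideal other than the maximal ideal lies in the
kernel of a `k`-algebra map to `k⟦X⟧` that does not kill all the variables. -/
theorem MvPowerSeries.exists_algHom_of_isPrime_of_ne_maximalIdeal {σ k : Type*} [Finite σ]
    [Field k] [IsAlgClosed k] [CharZero k] (P : Ideal (MvPowerSeries σ k)) [P.IsPrime]
    (hP : P ≠ IsLocalRing.maximalIdeal (MvPowerSeries σ k)) :
    ∃ Φ : MvPowerSeries σ k →ₐ[k] PowerSeries k, (∃ j, Φ (X j) ≠ 0) ∧ ∀ f ∈ P, Φ f = 0 := by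
  obtain ⟨Q, hPQ, hQ, hQm, hmax⟩ := IsLocalRing.exists_isPrime_maximal_ne P hP
  have hQle : Q ≤ IsLocalRing.maximalIdeal (MvPowerSeries σ k) :=
    IsLocalRing.le_maximalIdeal hQ.ne_top
  obtain ⟨j, hj⟩ : ∃ j, X j ∉ Q := by
    by_contra! h
    refine hQm (le_antisymm hQle ?_)
    rw [maximalIdeal_eq_span_range_X, Ideal.span_le]
    rintro _ ⟨i, rfl⟩
    exact h i
  -- By maximality of `Q`, the only prime containing `Q` and `X j` is the maximal ideal.
  have hrad : IsLocalRing.maximalIdeal (MvPowerSeries σ k) ≤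
      (Q ⊔ Ideal.span {X j}).radical := by
    rw [Ideal.radical_eq_sInf]
    refine le_sInf fun q ⟨hq, hqp⟩ => (hmax q hqp ?_).ge
    refine lt_of_le_of_ne (le_sup_left.trans hq) ?_
    rintro rfl
    exact hj (hq (Ideal.mem_sup_right (Ideal.mem_span_singleton_self _)))
  obtain ⟨N, hN⟩ := Ideal.exists_pow_le_of_le_radical_of_fg hrad (IsNoetherian.noetherian _)
  have := finite_quotient_maximalIdeal σ k
  have hfin : Module.Finite k (MvPowerSeries σ k ⧸ Q ⊔ Ideal.span {X j}) :=
    IsLocalRing.finite_quotient_of_pow_maximalIdeal_le hN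
  -- The coordinate `X j` makes the one-dimensional domain `A` a finite extension of `k⟦X⟧`.
  let A := MvPowerSeries σ k ⧸ Q
  let φ : PowerSeries k →ₐ[k] A :=
    (Ideal.Quotient.mkₐ k Q).comp (PowerSeries.toMvPowerSeries j)
  have hφX : φ PowerSeries.X = Ideal.Quotient.mk Q (X j) := by simp [φ]
  have hx0 : φ PowerSeries.X ≠ 0 := by
    rwa [hφX, Ne, Ideal.Quotient.eq_zero_iff_mem]
  have : Module.Finite k (A ⧸ Ideal.span {φ PowerSeries.X}) := by
    have hmap : Ideal.span {φ PowerSeries.X} =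
        (Ideal.span {X j}).map (Ideal.Quotient.mkₐ k Q) := by
      rw [Ideal.map_span, Set.image_singleton, hφX]
      rfl
    rw [hmap]
    exact .equiv (DoubleQuot.quotQuotEquivQuotSupₐ k Q (Ideal.span {X j})).symm.toLinearEquiv
  have : IsLocalRing A := .of_surjective' (Ideal.Quotient.mk Q) Ideal.Quotient.mk_surjective
  have hxu : ¬ IsUnit (φ PowerSeries.X) := by
    intro h
    have hXm : (X j : MvPowerSeries σ k) ∈ IsLocalRing.maximalIdeal (MvPowerSeries σ k) := by
      rw [maximalIdeal_eq_span_range_X]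
      exact Ideal.subset_span ⟨j, rfl⟩
    have h' := h.map (Ideal.Quotient.factor hQle)
    rw [hφX, Ideal.Quotient.factor_mk, Ideal.Quotient.eq_zero_iff_mem.mpr hXm] at h'
    exact not_isUnit_zero h'
  have hsep : ∀ a : A, (∀ n, φ PowerSeries.X ^ n ∣ a) → a = 0 := by
    intro a ha
    have h := Ideal.iInf_pow_eq_bot_of_isLocalRing (Ideal.span {φ PowerSeries.X})
      (by rwa [Ne, Ideal.span_singleton_eq_top])
    rw [← Ideal.mem_bot, ← h, Ideal.mem_iInf]
    intro n
    rw [Ideal.span_singleton_pow, Ideal.mem_span_singleton]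
    exact ha n
  have hφfin := PowerSeries.finite_of_finite_quotient_span_X φ hsep
  have hφinj : Function.Injective φ :=
    PowerSeries.injective_algHom_of_map_X_ne_zero φ hx0
  let _ : Algebra (PowerSeries k) A := φ.toRingHom.toAlgebra
  have : IsScalarTower k (PowerSeries k) A :=
    IsScalarTower.of_algebraMap_eq fun c => (φ.commutes c).symm
  have : Module.Finite (PowerSeries k) A := hφfin
  have : FaithfulSMul (PowerSeries k) A := (faithfulSMul_iff_algebraMap_injective _ _).mpr hφinj
  obtain ⟨ψ, hψ⟩ := PowerSeries.exists_injective_algHom_of_finite (k := k) (A := A)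
  refine ⟨ψ.comp (Ideal.Quotient.mkₐ k Q), ⟨j, ?_⟩, fun f hf => ?_⟩
  · have := (map_ne_zero_iff ψ hψ).mpr hx0
    rwa [hφX] at this
  · have : Ideal.Quotient.mk Q f = 0 := Ideal.Quotient.eq_zero_iff_mem.mpr (hPQ hf)
    change ψ (Ideal.Quotient.mk Q f) = 0
    rw [this, map_zero]

theorem mainTheorem3 (n : ℕ) (P : Ideal (MvPowerSeries (Fin n) ℂ)) (hP : P.IsPrime)
    (hdim : ¬ FiniteDimensional ℂ (MvPowerSeries (Fin n) ℂ ⧸ P)) :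
    ∃ ζ : Fin n → PowerSeries ℂ,
      (∀ j, PowerSeries.constantCoeff (ζ j) = 0) ∧
      (∃ j, ζ j ≠ 0) ∧
      ∀ f ∈ P, (MvPowerSeries.subst ζ f : PowerSeries ℂ) = 0 := by
  have hne : P ≠ IsLocalRing.maximalIdeal (MvPowerSeries (Fin n) ℂ) := by
    rintro rfl
    exact hdim (MvPowerSeries.finite_quotient_maximalIdeal (Fin n) ℂ)
  obtain ⟨Φ, hΦ, hΦP⟩ := MvPowerSeries.exists_algHom_of_isPrime_of_ne_maximalIdeal P hne
  exact ⟨fun i => Φ (MvPowerSeries.X i), MvPowerSeries.algHom_constantCoeff_X_eq_zero Φ, hΦ,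
    fun f hf => by rw [← MvPowerSeries.algHom_eq_subst]; exact hΦP f hf⟩
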